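/- For an integer $k\ge 2$ let $\mathcal{C}_{2k-1}=\{C_3,C_5,\dots,C_{2k-1}\}$ be the family of odd cycles of length at most $2k-1$; a finite simple graph $G$ is $\mathcal{C}_{2k-1}$-free if it contains no member of this family as a (not necessarily induced) subgraph. For a family $\mathcal{H}$ of finite graphs and an integer $c\ge 2$ let $$\delta_\chi(\mathcal{H},c)=\inf\{\alpha\in[0,1] : \text{every finite } \mathcal{H}\text{-free graph } G \text{ of minimum degree at least } \alpha|V(G)| \text{ satisfies } \chi(G)\le c\}.$$ Theorem. Let $t\ge 0$ be an integer and let $k\ge 5490+45t$ be an integer. Then every finite $\mathcal{C}_{2k-1}$-free graph $G$ of minimum degree at least $\frac{1}{2k+t}|V(G)|$ is $3$-colourable. In particular, $\delta_\chi(\mathcal{C}_{2k-1},3)\le\frac{1}{2k+t}$. -/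

import Mathlib

/-- A family of finite graphs; each member is given on a vertex set `Fin n`, that is, up to
isomorphism. -/
abbrev GraphFamily : Type := Set (Σ n : ℕ, SimpleGraph (Fin n))

/-- `𝒞_m`: the family of the odd cycles `C_3, C_5, …` of length at most `m`. -/
def oddCycleFamily (m : ℕ) : GraphFamily :=
  {F | ∃ l : ℕ, Odd l ∧ 3 ≤ l ∧ l ≤ m ∧ F = ⟨l, SimpleGraph.cycleGraph l⟩}

/-- `G` is `ℋ`-free: no member of `ℋ` is a (not necessarily induced) subgraph of `G`. -/
def FamilyFree (ℋ : GraphFamily) {V : Type*} (G : SimpleGraph V) : Prop :=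
  ∀ F ∈ ℋ, F.2.Free G

/-- `G` belongs to `𝒢(ℋ, α)`: the finite graph `G` is `ℋ`-free and has minimum degree at least
`α |V(G)|`. -/
def InMinDegreeClass (ℋ : GraphFamily) (α : ℝ) {V : Type*} [Fintype V]
    (G : SimpleGraph V) [DecidableRel G.Adj] : Prop :=
  FamilyFree ℋ G ∧ α * (Fintype.card V : ℝ) ≤ (G.minDegree : ℝ)

/-- The set of `α ∈ [0, 1]` such that all graphs in `𝒢(ℋ, α)` have chromatic number at
most `c`. -/
def profileSet (ℋ : GraphFamily) (c : ℕ) : Set ℝ :=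
  {α | α ∈ Set.Icc (0 : ℝ) 1 ∧
    ∀ (V : Type) [Fintype V] (G : SimpleGraph V) [DecidableRel G.Adj],
      InMinDegreeClass ℋ α G → G.chromaticNumber ≤ (c : ℕ∞)}

/-- The chromatic profile `δ_χ(ℋ, c)`. -/
noncomputable def chromaticProfile (ℋ : GraphFamily) (c : ℕ) : ℝ :=
  sInf (profileSet ℋ c)

/-- The infimum in `chromaticProfile` is over a nonempty set. -/
theorem profileSet_nonempty (ℋ : GraphFamily) (c : ℕ) : (profileSet ℋ c).Nonempty := by
  refine ⟨1, by simp, ?_⟩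
  intro V _ G _ h
  rcases isEmpty_or_nonempty V with hV | hV
  · exact (SimpleGraph.Colorable.of_isEmpty (G := G) c).chromaticNumber_le
  · exfalso
    have h2 : Fintype.card V ≤ G.minDegree := by
      have := h.2
      rw [one_mul] at this
      exact_mod_cast this
    have h3 := G.minDegree_le_degree (Classical.arbitrary V)
    have h4 := G.degree_lt_card_verts (Classical.arbitrary V)
    omega

/-- The infimum in `chromaticProfile` is over a set that is bounded below. -/
theorem profileSet_bddBelow (ℋ : GraphFamily) (c : ℕ) : BddBelow (profileSet ℋ c) :=
  ⟨0, fun _ h => h.1.1⟩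

/-! Work in one component, with shortest odd closed walk of length `2k + 1`, all degrees at least
`d`, and at most `(2k + t)d` vertices. Inside a ball of radius at most `k`, parity of distance is a
proper two-colouring, and spheres of radius below `k` are independent. So a graph that is not
3-colourable stays non-bipartite beyond each such sphere.

The engine is `OddWalksLong.le_card_nbrsOf`: a set inducing a non-bipartite graph has about `kd`
vertices in its neighbourhood, since otherwise balls with narrow boundaries could absorb it while
extending a two-colouring.

A shortest odd closed walk gives `v` and an edge `ab` with both ends at distance `k` from `v`; the
geodesics to `a` and `b` force about `kd` vertices near `v`. Without a 3-colouring, the outside of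
the ball costs another `kd`. A third geodesic, ending far from `a`, no longer fits, so the
`k`-sphere of `v` is concentrated near `a`. Some `w` has distance at least `k` from both `v` and
`a`, hence almost `2k` from `v`. Removing slightly smaller spheres around `v` and `w` leaves a
non-bipartite part, and the count `kd + kd + kd/2` is too large. -/

namespace SimpleGraph

open Finset

variable {V : Type*} {G : SimpleGraph V} {k : ℕ}

/-- Every odd closed walk of `G` has length more than `2 * k`. -/
def OddWalksLong (G : SimpleGraph V) (k : ℕ) : Prop :=
  ∀ (x : V) (c : G.Walk x x), Odd c.length → 2 * k + 1 ≤ c.length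

/-- There is a two-colouring of the subgraph of `G` induced by `W`. -/
def TwoColourableOn (G : SimpleGraph V) (W : Set V) : Prop :=
  ∃ χ : V → Bool, ∀ x ∈ W, ∀ y ∈ W, G.Adj x y → χ x ≠ χ y

/-! ### Short odd closed walks and odd cycles -/

/-- A closed walk that is shortest among the odd closed walks visits distinct vertices. -/
theorem Walk.getVert_ne_of_minimal_odd {x : V} (c : G.Walk x x) (hc : Odd c.length)
    (hmin : ∀ (y : V) (c' : G.Walk y y), Odd c'.length → c.length ≤ c'.length)
    {i j : ℕ} (hij : i < j) (hj : j < c.length) : c.getVert i ≠ c.getVert j := by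
  intro h
  -- A repeated vertex splits the walk into two shorter closed walks, one of them odd.
  let inner : G.Walk (c.getVert i) (c.getVert i) :=
    ((c.take j).drop i).copy (by rw [Walk.take_getVert]; congr 1; omega) h.symm
  let outer : G.Walk x x := (c.take i).append ((c.drop j).copy h.symm rfl)
  have hi : inner.length = j - i := by
    simp [inner, Walk.take_length, Walk.drop_length]; omega
  have ho : outer.length = i + (c.length - j) := by
    simp [outer, Walk.take_length, Walk.drop_length]; omega
  rcases Nat.even_or_odd (j - i) with he | hodd
  · have : Odd outer.length := by
      rw [ho]; rw [Nat.odd_iff] at hc ⊢; rw [Nat.even_iff] at he; omega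
    have := hmin _ _ this
    omega
  · have := hmin _ inner (hi ▸ hodd)
    omega

/-- A shortest odd closed walk yields a copy of the corresponding cycle graph. -/
theorem Walk.cycleGraph_isContained_of_minimal_odd {x : V} (c : G.Walk x x) (hc : Odd c.length)
    (hmin : ∀ (y : V) (c' : G.Walk y y), Odd c'.length → c.length ≤ c'.length) :
    (cycleGraph c.length).IsContained G := by
  have succ_adj : ∀ u v : Fin c.length, (u - v).val = 1 →
      G.Adj (c.getVert u) (c.getVert v) := by
    intro u v h
    rcases le_or_gt v u with h' | h'
    · have huv : (u : ℕ) = v + 1 := by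
        rw [Fin.sub_val_of_le h'] at h
        have : (v : ℕ) ≤ u := h'
        omega
      rw [huv]
      exact (c.adj_getVert_succ v.2).symm
    -- Wrap-around: this is the closing edge of the cycle.
    · rw [Fin.coe_sub_iff_lt.2 h'] at h
      have h0 : (u : ℕ) = 0 := by have := v.2; omega
      have hv : (v : ℕ) + 1 = c.length := by have := v.2; omega
      have := c.adj_getVert_succ v.2
      rw [hv, Walk.getVert_length] at this
      rw [h0, Walk.getVert_zero]
      exact this.symm
  let f : cycleGraph c.length →g G :=
    ⟨fun i => c.getVert i, fun {u v} h => by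
      rw [cycleGraph_adj'] at h
      rcases h with h | h
      · exact succ_adj u v h
      · exact (succ_adj v u h).symm⟩
  refine ⟨⟨f, fun u v h => ?_⟩⟩
  by_contra hne
  rcases lt_or_gt_of_ne hne with hlt | hlt
  · exact c.getVert_ne_of_minimal_odd hc hmin hlt v.2 h
  · exact c.getVert_ne_of_minimal_odd hc hmin hlt u.2 h.symm

/-- If `G` has an odd closed walk, then it has a shortest one. -/
theorem exists_minimal_odd_walk {x : V} (c : G.Walk x x) (hc : Odd c.length) :
    ∃ (y : V) (c₀ : G.Walk y y), Odd c₀.length ∧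
      ∀ (z : V) (c' : G.Walk z z), Odd c'.length → c₀.length ≤ c'.length := by
  classical
  have hex : ∃ n, ∃ (y : V) (c₀ : G.Walk y y), Odd c₀.length ∧ c₀.length = n := ⟨_, x, c, hc, rfl⟩
  obtain ⟨y, c₀, h₀, hn⟩ := Nat.find_spec hex
  exact ⟨y, c₀, h₀, fun z c' h' => hn ▸ Nat.find_min' hex ⟨z, c', h', rfl⟩⟩

theorem three_le_length_of_odd {x : V} (c : G.Walk x x) (hc : Odd c.length) : 3 ≤ c.length := by
  by_contra h
  have h1 : c.length = 1 := by rw [Nat.odd_iff] at hc; omega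
  exact G.irrefl (Walk.adj_of_length_eq_one h1)

theorem oddWalksLong_of_familyFree (h : FamilyFree (oddCycleFamily (2 * k - 1)) G) :
    OddWalksLong G k := by
  intro x c hc
  obtain ⟨y, c₀, h₀, hmin⟩ := exists_minimal_odd_walk c hc
  refine le_trans ?_ (hmin x c hc)
  by_contra hlt
  refine h ⟨c₀.length, cycleGraph c₀.length⟩
    ⟨c₀.length, h₀, three_le_length_of_odd c₀ h₀, ?_, rfl⟩
    (c₀.cycleGraph_isContained_of_minimal_odd h₀ hmin)
  rw [Nat.odd_iff] at h₀
  omega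

/-! ### Distances in a connected graph without short odd closed walks -/

theorem Connected.dist_le_succ_of_adj (hG : G.Connected) {a b : V} (x : V) (h : G.Adj a b) :
    G.dist x a ≤ G.dist x b + 1 := by
  have := hG.dist_triangle (u := x) (v := b) (w := a)
  rwa [dist_eq_one_iff_adj.2 h.symm] at this

theorem Connected.exists_dist_eq (hG : G.Connected) {x y : V} {i n : ℕ} (hxy : G.dist x y = n)
    (hi : i ≤ n) : ∃ z, G.dist x z = i ∧ G.dist z y = n - i := by
  obtain ⟨w, hw⟩ := hG.exists_walk_length_eq_dist x y
  have h1 := dist_le (w.take i)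
  have h2 := dist_le (w.drop i)
  rw [Walk.take_length] at h1
  rw [Walk.drop_length] at h2
  have := hG.dist_triangle (u := x) (v := w.getVert i) (w := y)
  exact ⟨w.getVert i, by omega, by omega⟩

theorem OddWalksLong.two_mul_lt_of_quadrangle (hG : G.Connected) (H : OddWalksLong G k)
    (x y z w : V) (h : Odd (G.dist x y + G.dist y z + G.dist z w + G.dist w x)) :
    2 * k + 1 ≤ G.dist x y + G.dist y z + G.dist z w + G.dist w x := by
  obtain ⟨w₁, h₁⟩ := hG.exists_walk_length_eq_dist x y
  obtain ⟨w₂, h₂⟩ := hG.exists_walk_length_eq_dist y z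
  obtain ⟨w₃, h₃⟩ := hG.exists_walk_length_eq_dist z w
  obtain ⟨w₄, h₄⟩ := hG.exists_walk_length_eq_dist w x
  have := H x (((w₁.append w₂).append w₃).append w₄)
  simp only [Walk.length_append, h₁, h₂, h₃, h₄] at this
  exact this h

theorem OddWalksLong.two_mul_lt_of_triangle (hG : G.Connected) (H : OddWalksLong G k)
    (x y z : V) (h : Odd (G.dist x y + G.dist y z + G.dist z x)) :
    2 * k + 1 ≤ G.dist x y + G.dist y z + G.dist z x := by
  have := H.two_mul_lt_of_quadrangle hG x y z z
  simp only [dist_self, add_zero] at this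
  exact this h

/-- An edge inside level `j` closes an odd walk of length `2j + 1`. -/
theorem OddWalksLong.dist_ne_of_adj (hG : G.Connected) (H : OddWalksLong G k) {x a b : V}
    (hab : G.Adj a b) (ha : G.dist x a < k) : G.dist x a ≠ G.dist x b := by
  intro h
  have := H.two_mul_lt_of_triangle hG x a b
  rw [dist_eq_one_iff_adj.2 hab, G.dist_comm (u := b), ← h] at this
  have := this ⟨G.dist x a, by ring⟩
  omega

theorem OddWalksLong.twoColourableOn_ball (hG : G.Connected) (H : OddWalksLong G k) (x : V) :
    ∀ a b, G.Adj a b → G.dist x a < k →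
      decide (Even (G.dist x a)) ≠ decide (Even (G.dist x b)) := by
  intro a b hab ha
  have h1 := H.dist_ne_of_adj hG hab ha
  have h2 := hG.dist_le_succ_of_adj x hab
  have h3 := hG.dist_le_succ_of_adj x hab.symm
  simp only [ne_eq, decide_eq_decide, Nat.even_iff]
  omega

/-- The ends of the middle edge of a shortest odd closed walk are equidistant from its start. -/
theorem exists_adj_dist_eq (hG : G.Connected) {v : V} (c : G.Walk v v)
    (hc : c.length = 2 * k + 1) (H : OddWalksLong G k) :
    ∃ a b, G.Adj a b ∧ G.dist v a = k ∧ G.dist v b = k := by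
  have hadj := c.adj_getVert_succ (i := k) (by omega)
  set a := c.getVert k
  set b := c.getVert (k + 1)
  have ha : G.dist v a ≤ k := by
    have : G.dist v a ≤ _ := dist_le (c.take k)
    rw [Walk.take_length] at this; omega
  have hb : G.dist v b ≤ k := by
    have : G.dist b v ≤ _ := dist_le (c.drop (k + 1))
    rw [Walk.drop_length, dist_comm] at this; omega
  -- A geodesic of the wrong parity, closed up by half of `c`, would be an odd closed walk of length
  -- at most `2k`.
  have walk_a : ¬ Odd (G.dist v a + k) := by
    obtain ⟨w, hw⟩ := hG.exists_walk_length_eq_dist v a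
    have := H v (w.append (c.take k).reverse)
    rw [Walk.length_append, Walk.length_reverse, Walk.take_length, hw,
      min_eq_left (by omega)] at this
    intro h
    have := this h
    omega
  have walk_b : ¬ Odd (G.dist v b + k) := by
    obtain ⟨w, hw⟩ := hG.exists_walk_length_eq_dist v b
    have := H v (w.append (c.drop (k + 1)))
    rw [Walk.length_append, Walk.drop_length, hw,
      show c.length - (k + 1) = k by omega] at this
    intro h
    have := this h
    omega
  have htri := H.two_mul_lt_of_triangle hG v a b
  rw [dist_eq_one_iff_adj.2 hadj, G.dist_comm (u := b)] at htri
  have : Odd (G.dist v a + 1 + G.dist v b) := by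
    rw [Nat.not_odd_iff] at walk_a walk_b
    rw [Nat.odd_iff]; omega
  have := htri this
  exact ⟨a, b, hadj, by omega, by omega⟩

/-! ### Counting neighbourhoods -/

section Counting

open Classical in
/-- The neighbours of `x`, as a finset. -/
noncomputable def nbrs {V : Type*} [Fintype V] (G : SimpleGraph V) (x : V) : Finset V :=
  univ.filter (G.Adj x)

open Classical in
/-- The vertices with a neighbour in `W`. -/
noncomputable def nbrsOf {V : Type*} [Fintype V] (G : SimpleGraph V) (W : Set V) : Finset V :=
  univ.filter fun z => ∃ x ∈ W, G.Adj x z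

theorem add_le_card_of_disjoint {V : Type*} {X A B : Finset V} {a b : ℕ} (hA : A ⊆ X) (hB : B ⊆ X)
    (hAB : Disjoint A B) (ha : a ≤ A.card) (hb : b ≤ B.card) : a + b ≤ X.card := by
  classical
  have := card_le_card (union_subset hA hB)
  rw [card_union_of_disjoint hAB] at this
  omega

/-- If each window of four consecutive levels of `f` from the `m₁`-st to the `m₂`-th contains at
least `c` elements, then these windows together contain at least `(m₂ - m₁) * c` elements. -/
theorem mul_le_card_of_windows {V : Type*} (f : V → ℕ) (X : Finset V) (c m₁ m₂ : ℕ)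
    (h : ∀ m, m₁ ≤ m → m < m₂ → c ≤ (X.filter fun z => f z / 4 = m).card) :
    (m₂ - m₁) * c ≤ (X.filter fun z => 4 * m₁ ≤ f z ∧ f z < 4 * m₂).card := by
  classical
  rw [card_eq_sum_card_fiberwise (f := fun z => f z / 4) (t := Ico m₁ m₂)]
  · rw [← Nat.card_Ico, ← smul_eq_mul]
    refine card_nsmul_le_sum _ _ _ fun m hm => ?_
    rw [mem_Ico] at hm
    refine (h m hm.1 hm.2).trans (card_le_card fun z hz => ?_)
    simp only [mem_filter] at hz ⊢
    exact ⟨⟨hz.1, by omega, by omega⟩, hz.2⟩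
  · intro z hz
    simp only [coe_filter, Set.mem_ofPred_eq] at hz
    simp only [coe_Ico, Set.mem_Ico]
    omega

variable {V : Type*} [Fintype V] {G : SimpleGraph V} {k d : ℕ}

theorem mem_nbrs {x z : V} : z ∈ G.nbrs x ↔ G.Adj x z := by simp [nbrs]

theorem mem_nbrsOf {W : Set V} {z : V} : z ∈ G.nbrsOf W ↔ ∃ x ∈ W, G.Adj x z := by
  simp [nbrsOf]

theorem add_add_le_card_of_disjoint {A B C : Finset V} {a b c : ℕ}
    (hAB : Disjoint A B) (hAC : Disjoint A C) (hBC : Disjoint B C)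
    (ha : a ≤ A.card) (hb : b ≤ B.card) (hc : c ≤ C.card) : a + b + c ≤ Fintype.card V := by
  classical
  refine add_le_card_of_disjoint (X := univ) (A := A ∪ B) (subset_univ _) (subset_univ _)
    (disjoint_union_left.2 ⟨hAC, hBC⟩) ?_ hc
  exact add_le_card_of_disjoint subset_union_left subset_union_right hAB ha hb

theorem Connected.disjoint_nbrs_of_two_lt (hG : G.Connected) {p q : V} (h : 2 < G.dist p q) :
    Disjoint (G.nbrs p) (G.nbrs q) := by
  rw [Finset.disjoint_left]
  intro z hp hq
  have h1 := dist_eq_one_iff_adj.2 (mem_nbrs.1 hp)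
  have h2 := dist_eq_one_iff_adj.2 (mem_nbrs.1 hq).symm
  have := hG.dist_triangle (u := p) (v := z) (w := q)
  omega

theorem OddWalksLong.dist_of_mem_nbrs (hG : G.Connected) (H : OddWalksLong G k) {x p z : V}
    {j : ℕ} (hp : G.dist x p = j) (hj : j < k) (hz : z ∈ G.nbrs p) :
    G.dist x z = j + 1 ∨ G.dist x z + 1 = j := by
  have h := mem_nbrs.1 hz
  have h1 := H.dist_ne_of_adj hG h (hp ▸ hj)
  have h2 := hG.dist_le_succ_of_adj x h
  have h3 := hG.dist_le_succ_of_adj x h.symm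
  omega

/-- Two consecutive levels contribute disjoint neighbourhoods to a window of four levels. -/
theorem OddWalksLong.add_le_card_window (hG : G.Connected) (H : OddWalksLong G k) {x : V}
    {m e : ℕ} (hm : 4 * m + 3 ≤ k) {X A B : Finset V}
    (hA : A ⊆ X) (hB : B ⊆ X)
    (hA' : ∀ z ∈ A, ∃ p, G.dist x p = 4 * m + 1 ∧ z ∈ G.nbrs p)
    (hB' : ∀ z ∈ B, ∃ p, G.dist x p = 4 * m + 2 ∧ z ∈ G.nbrs p)
    (hAe : e ≤ A.card) (hBe : e ≤ B.card) :
    2 * e ≤ (X.filter fun z => G.dist x z / 4 = m).card := by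
  -- `A` and `B` occupy levels of opposite parity, hence are disjoint.
  have levelA : ∀ z ∈ A, G.dist x z = 4 * m + 2 ∨ G.dist x z = 4 * m := by
    intro z hz
    obtain ⟨p, hp, hzp⟩ := hA' z hz
    have := H.dist_of_mem_nbrs hG hp (by omega) hzp
    omega
  have levelB : ∀ z ∈ B, G.dist x z = 4 * m + 3 ∨ G.dist x z = 4 * m + 1 := by
    intro z hz
    obtain ⟨p, hp, hzp⟩ := hB' z hz
    have := H.dist_of_mem_nbrs hG hp (by omega) hzp
    omega
  rw [two_mul]
  refine add_le_card_of_disjoint (A := A) (B := B) ?_ ?_ ?_ hAe hBe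
  · intro z hz
    have := levelA z hz
    exact mem_filter.2 ⟨hA hz, by omega⟩
  · intro z hz
    have := levelB z hz
    exact mem_filter.2 ⟨hB hz, by omega⟩
  · rw [Finset.disjoint_left]
    intro z hz hz'
    have := levelA z hz
    have := levelB z hz'
    omega

/-- Two pairs of vertices of a window that are far apart contribute four neighbourhoods. -/
theorem OddWalksLong.four_mul_le_card_window (hG : G.Connected) (H : OddWalksLong G k)
    (hd : ∀ x, d ≤ (G.nbrs x).card) {x : V} {m : ℕ} (hm : 4 * m + 3 ≤ k) {X : Finset V}
    {p q p' q' : V} (hp : G.dist x p = 4 * m + 1) (hp' : G.dist x p' = 4 * m + 1)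
    (hq : G.dist x q = 4 * m + 2) (hq' : G.dist x q' = 4 * m + 2)
    (hpp : 2 < G.dist p p') (hqq : 2 < G.dist q q')
    (hX : ∀ z, z = p ∨ z = q ∨ z = p' ∨ z = q' → G.nbrs z ⊆ X) :
    4 * d ≤ (X.filter fun z => G.dist x z / 4 = m).card := by
  classical
  have key : ∀ a b, 2 < G.dist a b → 2 * d ≤ (G.nbrs a ∪ G.nbrs b).card := by
    intro a b hab
    rw [card_union_of_disjoint (hG.disjoint_nbrs_of_two_lt hab)]
    have := hd a
    have := hd b
    omega
  have := H.add_le_card_window hG hm (X := X) (A := G.nbrs p ∪ G.nbrs p')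
    (B := G.nbrs q ∪ G.nbrs q') (x := x)
    (union_subset (hX _ (by simp)) (hX _ (by simp)))
    (union_subset (hX _ (by simp)) (hX _ (by simp)))
    (fun z hz => (mem_union.1 hz).elim (fun h => ⟨p, hp, h⟩) fun h => ⟨p', hp', h⟩)
    (fun z hz => (mem_union.1 hz).elim (fun h => ⟨q, hq, h⟩) fun h => ⟨q', hq', h⟩)
    (key _ _ hpp) (key _ _ hqq)
  omega

/-- Three pairs of vertices of a window that are far apart contribute six neighbourhoods. -/
theorem OddWalksLong.six_mul_le_card_window (hG : G.Connected) (H : OddWalksLong G k)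
    (hd : ∀ x, d ≤ (G.nbrs x).card) {x : V} {m : ℕ} (hm : 4 * m + 3 ≤ k)
    {p q p' q' g h : V} (hp : G.dist x p = 4 * m + 1) (hp' : G.dist x p' = 4 * m + 1)
    (hg : G.dist x g = 4 * m + 1)
    (hq : G.dist x q = 4 * m + 2) (hq' : G.dist x q' = 4 * m + 2) (hh : G.dist x h = 4 * m + 2)
    (hpp : 2 < G.dist p p') (hqq : 2 < G.dist q q') (hpg : 2 < G.dist p g)
    (hpg' : 2 < G.dist p' g) (hqh : 2 < G.dist q h) (hqh' : 2 < G.dist q' h) :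
    6 * d ≤ ((univ : Finset V).filter fun z => G.dist x z / 4 = m).card := by
  classical
  have key : ∀ a b c, 2 < G.dist a b → 2 < G.dist a c → 2 < G.dist b c →
      3 * d ≤ (G.nbrs a ∪ G.nbrs b ∪ G.nbrs c).card := by
    intro a b c hab hac hbc
    rw [card_union_of_disjoint (disjoint_union_left.2 ⟨hG.disjoint_nbrs_of_two_lt hac,
      hG.disjoint_nbrs_of_two_lt hbc⟩), card_union_of_disjoint (hG.disjoint_nbrs_of_two_lt hab)]
    have := hd a
    have := hd b
    have := hd c
    omega
  have := H.add_le_card_window hG hm (X := univ) (A := G.nbrs p ∪ G.nbrs p' ∪ G.nbrs g)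
    (B := G.nbrs q ∪ G.nbrs q' ∪ G.nbrs h) (x := x) (subset_univ _) (subset_univ _)
    (fun z hz => by
      rcases mem_union.1 hz with hz | hz
      · exact (mem_union.1 hz).elim (fun h => ⟨p, hp, h⟩) fun h => ⟨p', hp', h⟩
      · exact ⟨g, hg, hz⟩)
    (fun z hz => by
      rcases mem_union.1 hz with hz | hz
      · exact (mem_union.1 hz).elim (fun h => ⟨q, hq, h⟩) fun h => ⟨q', hq', h⟩
      · exact ⟨h, hh, hz⟩)
    (key _ _ _ hpp hpg hpg') (key _ _ _ hqq hqh hqh')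
  omega

/-- A window that is met by the geodesics from `x` contains two neighbourhoods. -/
theorem OddWalksLong.two_mul_le_card_window (hG : G.Connected) (H : OddWalksLong G k)
    (hd : ∀ x, d ≤ (G.nbrs x).card) {x y : V} {m : ℕ} (hm : 4 * m + 3 ≤ k)
    (hy : 4 * m + 2 ≤ G.dist x y) :
    2 * d ≤ ((univ : Finset V).filter fun z => G.dist x z / 4 = m).card := by
  obtain ⟨p, hp, -⟩ := hG.exists_dist_eq (x := x) (y := y) rfl (i := 4 * m + 1) (by omega)
  obtain ⟨q, hq, -⟩ := hG.exists_dist_eq (x := x) (y := y) rfl hy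
  exact H.add_le_card_window hG hm (subset_univ _) (subset_univ _) (fun z hz => ⟨p, hp, hz⟩)
    (fun z hz => ⟨q, hq, hz⟩) (hd p) (hd q)

end Counting

/-! ### Sets that do not induce a bipartite graph have large neighbourhoods -/

section Absorption

variable {V : Type*} {G : SimpleGraph V} {k : ℕ}

/-- The vertices of `S` with a neighbour in `W` outside `S`. -/
def boundaryIn (G : SimpleGraph V) (W S : Set V) : Set V :=
  {p | p ∈ S ∧ ∃ q ∈ W, q ∉ S ∧ G.Adj p q}

/-- A subset of `W` that has a two-colouring in which its boundary in `W` is monochromatic, and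
whose boundary in `W` has pairwise distances zero, two or four in `G`. -/
structure IsAbsorbed (G : SimpleGraph V) (W S : Set V) : Prop where
  subset : S ⊆ W
  colouring : ∃ χ : V → Bool, (∀ x ∈ S, ∀ y ∈ S, G.Adj x y → χ x ≠ χ y) ∧
    ∀ p ∈ G.boundaryIn W S, χ p = true
  dist_mem : ∀ p ∈ G.boundaryIn W S, ∀ p' ∈ G.boundaryIn W S,
    G.dist p p' = 0 ∨ G.dist p p' = 2 ∨ G.dist p p' = 4

/-- Level `i + 1` around `y` is narrow in `W`: those of its vertices in `W` that have a neighbour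
in `W` at level `i + 2` have pairwise distance at most four. -/
def NarrowAt (G : SimpleGraph V) (W : Set V) (y : V) (i : ℕ) : Prop :=
  ∀ p ∈ W, ∀ q ∈ W, ∀ p' ∈ W, ∀ q' ∈ W, G.Adj p q → G.Adj p' q' →
    G.dist y p = i + 1 → G.dist y q = i + 2 → G.dist y p' = i + 1 → G.dist y q' = i + 2 →
    G.dist p p' ≤ 4

/-- The old boundary is within distance four of `y`, so its neighbours in `W` are swallowed and the
new boundary lies at level `i + 1`. There narrowness bounds the distances and the absence of short
odd walks makes them even. The old boundary is coloured `true` and at even distance from `y`, so `χ`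
and parity glue. -/
theorem IsAbsorbed.union_ball (hG : G.Connected) (H : OddWalksLong G k) {W S : Set V}
    (hS : IsAbsorbed G W S) {y : V} {i : ℕ} (hi : 4 ≤ i) (hik : i + 4 ≤ k)
    (hy : NarrowAt G W y i)
    (hyS : ∀ p ∈ G.boundaryIn W S, G.dist y p = 0 ∨ G.dist y p = 2 ∨ G.dist y p = 4) :
    IsAbsorbed G W (S ∪ {z ∈ W | G.dist y z ≤ i + 1}) := by
  classical
  obtain ⟨χ, hχ, hχS⟩ := hS.colouring
  have parity := H.twoColourableOn_ball hG y
  have hbd : ∀ p ∈ G.boundaryIn W (S ∪ {z ∈ W | G.dist y z ≤ i + 1}),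
      p ∉ S ∧ p ∈ W ∧ G.dist y p = i + 1 ∧ ∃ q ∈ W, G.Adj p q ∧ G.dist y q = i + 2 := by
    rintro p ⟨hp, q, hqW, hq, hpq⟩
    simp only [Set.mem_union, Set.mem_ofPred_eq, not_or, not_and, not_le] at hq
    have hdq := hq.2 hqW
    have h1 := hG.dist_le_succ_of_adj y hpq.symm
    have hpS : p ∉ S := by
      intro hpS
      have := hyS p ⟨hpS, q, hqW, hq.1, hpq⟩
      omega
    have hp' := hp.resolve_left hpS
    have := hp'.2
    exact ⟨hpS, hp'.1, by omega, q, hqW, hpq, by omega⟩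
  -- the sign makes the new boundary `true`; on the old boundary `e` is the parity
  let s : Bool := decide (Even (i + 1))
  let e : V → Bool := fun z => decide (Even (G.dist y z))
  have he : ∀ p ∈ G.boundaryIn W S, e p = true := by
    intro p hp
    have := hyS p hp
    simp only [e, decide_eq_true_eq, Nat.even_iff]
    omega
  have cross : ∀ a ∈ S, ∀ b, b ∈ W → b ∉ S → G.dist y b ≤ i + 1 → G.Adj a b → χ a ≠ e b := by
    intro a ha b hbW hbS hb hab
    have hK : a ∈ G.boundaryIn W S := ⟨ha, b, hbW, hbS, hab⟩
    rw [hχS a hK, ← he a hK]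
    have := hyS a hK
    exact parity a b hab (by omega)
  have colour : ∀ a ∈ S ∪ {z ∈ W | G.dist y z ≤ i + 1},
      ∀ b ∈ S ∪ {z ∈ W | G.dist y z ≤ i + 1}, G.Adj a b →
      (if a ∈ S then χ a else e a) ≠ (if b ∈ S then χ b else e b) := by
    intro a ha b hb hab
    by_cases haS : a ∈ S <;> by_cases hbS : b ∈ S <;> simp only [haS, hbS, if_true, if_false]
    · exact hχ a haS b hbS hab
    · exact cross a haS b (hb.resolve_left hbS).1 hbS (hb.resolve_left hbS).2 hab
    · exact (cross b hbS a (ha.resolve_left haS).1 haS (ha.resolve_left haS).2 hab.symm).symm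
    · have := (ha.resolve_left haS).2
      exact parity a b hab (by omega)
  have beq_inj : ∀ α β s : Bool, (α == s) = (β == s) → α = β := by decide
  refine ⟨Set.union_subset hS.subset fun z hz => hz.1,
    ⟨fun z => (if z ∈ S then χ z else e z) == s, ?_, ?_⟩, ?_⟩
  · intro a ha b hb hab h
    exact colour a ha b hb hab (beq_inj _ _ s h)
  · intro p hp
    obtain ⟨hpS, -, hdp, -⟩ := hbd p hp
    simp [hpS, e, s, hdp]
  · intro p hp p' hp'
    obtain ⟨-, hpW, hdp, q, hqW, hpq, hdq⟩ := hbd p hp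
    obtain ⟨-, hpW', hdp', q', hqW', hpq', hdq'⟩ := hbd p' hp'
    have h4 := hy p hpW q hqW p' hpW' q' hqW' hpq hpq' hdp hdq hdp' hdq'
    have htri := H.two_mul_lt_of_triangle hG y p p'
    rw [G.dist_comm (u := p') (v := y), hdp, hdp', Nat.odd_iff] at htri
    omega

variable [Fintype V] {d : ℕ}

/-- Around each vertex, a set with a small neighbourhood is narrow at some level. -/
theorem OddWalksLong.exists_narrowAt (hG : G.Connected) (H : OddWalksLong G k)
    (hd : ∀ x, d ≤ (G.nbrs x).card) {W : Set V}
    (hW : (G.nbrsOf W).card < (k / 4 - 1) * (4 * d)) (y : V) :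
    ∃ i, 4 ≤ i ∧ i + 4 ≤ k ∧ NarrowAt G W y i := by
  by_contra! hcon
  refine absurd (mul_le_card_of_windows (G.dist y) (G.nbrsOf W) (4 * d) 1 (k / 4) ?_)
    (not_le.2 (lt_of_le_of_lt (card_le_card (filter_subset _ _)) hW))
  intro m hm hmk
  -- Failure at `i = 4m` puts four neighbourhoods into window `m`; window 0 is lost to `4 ≤ i`.
  have hnar := hcon (4 * m) (by omega) (by omega)
  unfold NarrowAt at hnar
  push Not at hnar
  obtain ⟨p, hp, q, hq, p', hp', q', hq', hpq, hpq', hdp, hdq, hdp', hdq', hlt⟩ := hnar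
  have hqq : 2 < G.dist q q' := by
    have h1 := hG.dist_triangle (u := p) (v := q) (w := p')
    have h2 := hG.dist_triangle (u := q) (v := q') (w := p')
    rw [dist_eq_one_iff_adj.2 hpq] at h1
    rw [dist_eq_one_iff_adj.2 hpq'.symm] at h2
    omega
  refine H.four_mul_le_card_window hG hd (by omega) hdp hdp' hdq hdq' (by omega) hqq ?_
  intro z hz w hw
  refine mem_nbrsOf.2 ⟨z, ?_, mem_nbrs.1 hw⟩
  rcases hz with rfl | rfl | rfl | rfl <;> assumption

/-- A set that does not induce a bipartite graph has a large neighbourhood. -/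
theorem OddWalksLong.le_card_nbrsOf (hG : G.Connected) (H : OddWalksLong G k)
    (hd : ∀ x, d ≤ (G.nbrs x).card) {W : Set V} (hW : ¬ TwoColourableOn G W) :
    (k / 4 - 1) * (4 * d) ≤ (G.nbrsOf W).card := by
  classical
  by_contra! hlt
  have hempty : IsAbsorbed G W ∅ :=
    ⟨Set.empty_subset _, ⟨fun _ => true, by simp, fun _ h => h.1.elim⟩, fun _ h => h.1.elim⟩
  -- A boundary vertex of `S` is itself an admissible centre, by `dist_mem`, and its ball would
  -- capture a neighbour outside `S`. So a maximal `S` has empty boundary, and then every vertex of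
  -- `W` is an admissible centre.
  obtain ⟨S, hS, hmax⟩ := (Set.toFinite {S : Set V | IsAbsorbed G W S}).exists_maximal
    ⟨∅, hempty⟩
  have hgrow : ∀ y ∈ W, (∀ p ∈ G.boundaryIn W S,
      G.dist y p = 0 ∨ G.dist y p = 2 ∨ G.dist y p = 4) →
      ∀ z ∈ W, G.dist y z ≤ 1 → z ∈ S := by
    intro y hyW hy z hz hyz
    obtain ⟨i, hi, hik, hnar⟩ := H.exists_narrowAt hG hd hlt y
    refine hmax (IsAbsorbed.union_ball hG H hS hi hik hnar hy) Set.subset_union_left ?_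
    exact Or.inr ⟨hz, by omega⟩
  refine hW ?_
  obtain ⟨χ, hχ, -⟩ := hS.colouring
  have hWS : W ⊆ S := by
    rcases (G.boundaryIn W S).eq_empty_or_nonempty with h0 | ⟨y, hy⟩
    · intro z hz
      exact hgrow z hz (by simp [h0]) z hz (by simp)
    · obtain ⟨hyS, q, hq, hqS, hyq⟩ := id hy
      exact absurd (hgrow y (hS.subset hyS) (hS.dist_mem y hy) q hq
        (dist_eq_one_iff_adj.2 hyq).le) hqS
  exact ⟨χ, fun x hx y hy => hχ x (hWS hx) y (hWS hy)⟩

end Absorption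

/-! ### Colouring after removing spheres -/

section Spheres

variable {V : Type*} {G : SimpleGraph V} {k : ℕ}

/-- If removing an independent set leaves a bipartite graph, the graph is three-colourable. -/
theorem TwoColourableOn.colorable_three {I : Set V} (h : TwoColourableOn G Iᶜ)
    (hI : ∀ x ∈ I, ∀ y ∈ I, ¬ G.Adj x y) : G.Colorable 3 := by
  classical
  obtain ⟨χ, hχ⟩ := h
  let f : V → Option Bool := fun z => if z ∈ I then none else some (χ z)
  have hf : ∀ {a b : V}, G.Adj a b → f a ≠ f b := by
    intro a b hab
    by_cases ha : a ∈ I <;> by_cases hb : b ∈ I <;> simp only [f, ha, hb, if_true, if_false]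
    · exact absurd hab (hI a ha b hb)
    · simp
    · simp
    · exact fun h => hχ a ha b hb hab (Option.some.inj h)
  have := (Coloring.mk f hf).colorable
  simpa using this

theorem TwoColourableOn.mono {W W' : Set V} (h : TwoColourableOn G W) (hW : W' ⊆ W) :
    TwoColourableOn G W' := by
  obtain ⟨χ, hχ⟩ := h
  exact ⟨χ, fun x hx y hy => hχ x (hW hx) y (hW hy)⟩

/-- An open ball of radius at most `k` can be added to a set avoiding its bounding sphere. -/
theorem TwoColourableOn.union_ball (hG : G.Connected) (H : OddWalksLong G k) {W : Set V} {v : V}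
    {r : ℕ} (hr : r ≤ k) (hW : TwoColourableOn G (W ∩ {z | r < G.dist v z})) :
    TwoColourableOn G (W ∩ {z | G.dist v z ≠ r}) := by
  classical
  obtain ⟨χ, hχ⟩ := hW
  have parity := H.twoColourableOn_ball hG v
  refine ⟨fun z => if G.dist v z < r then decide (Even (G.dist v z)) else χ z, ?_⟩
  rintro a ⟨haW, ha⟩ b ⟨hbW, hb⟩ hab
  have h1 := hG.dist_le_succ_of_adj v hab
  have h2 := hG.dist_le_succ_of_adj v hab.symm
  have ha' : G.dist v a ≠ r := ha
  have hb' : G.dist v b ≠ r := hb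
  by_cases har : G.dist v a < r <;> by_cases hbr : G.dist v b < r
  · simp only [har, hbr, if_true]
    exact parity a b hab (by omega)
  · omega
  · omega
  · simp only [har, hbr, if_false]
    refine hχ a ⟨haW, ?_⟩ b ⟨hbW, ?_⟩ hab
    · change r < G.dist v a; omega
    · change r < G.dist v b; omega

theorem OddWalksLong.colorable_three_of_sphere (hG : G.Connected) (H : OddWalksLong G k) {v : V}
    {r : ℕ} (hr : r < k) (h : TwoColourableOn G {z | r < G.dist v z}) : G.Colorable 3 := by
  refine TwoColourableOn.colorable_three (I := {z | G.dist v z = r}) ?_ ?_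
  · have := TwoColourableOn.union_ball hG H (W := Set.univ) (v := v) hr.le (by simpa using h)
    exact this.mono fun z hz => ⟨trivial, hz⟩
  · intro x hx y hy hxy
    rw [Set.mem_ofPred_eq] at hx hy
    exact H.dist_ne_of_adj hG hxy (x := v) (by omega) (by omega)

/-- The distance condition forbids edges between the two spheres, so their union is independent. -/
theorem OddWalksLong.colorable_three_of_spheres (hG : G.Connected) (H : OddWalksLong G k)
    {v w : V} {r : ℕ} (hr : r < k) (hvw : 2 * r + 2 ≤ G.dist v w)
    (h : TwoColourableOn G {z | r < G.dist v z ∧ r < G.dist w z}) : G.Colorable 3 := by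
  refine TwoColourableOn.colorable_three (I := {z | G.dist v z = r ∨ G.dist w z = r}) ?_ ?_
  · have h1 := TwoColourableOn.union_ball hG H (W := {z | r < G.dist w z}) (v := v) hr.le
      (h.mono fun z hz => ⟨hz.2, hz.1⟩)
    have h2 := TwoColourableOn.union_ball hG H (W := {z | G.dist v z ≠ r}) (v := w) hr.le
      (h1.mono fun z hz => ⟨hz.2, hz.1⟩)
    exact h2.mono fun z hz => not_or.1 hz
  · have far : ∀ x y, G.dist v x = r → G.dist w y = r → ¬ G.Adj x y := by
      intro x y hx hy hxy
      have h1 := hG.dist_triangle (u := v) (v := y) (w := w)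
      have h2 := hG.dist_le_succ_of_adj v hxy.symm
      rw [G.dist_comm (u := y)] at h1
      omega
    rintro x (hx | hx) y (hy | hy) hxy
    · exact H.dist_ne_of_adj hG hxy (x := v) (by omega) (by omega)
    · exact far x y hx hy hxy
    · exact far y x hy hx hxy.symm
    · exact H.dist_ne_of_adj hG hxy (x := w) (by omega) (by omega)

/-! ### The two geodesics of a shortest odd closed walk -/

/-- Vertices at equal level on the two geodesics from `v` to the ends of a horizontal edge at
level `k` are far apart. -/
theorem OddWalksLong.two_lt_dist_of_geodesics (hG : G.Connected) (H : OddWalksLong G k) {v a b : V}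
    (hab : G.Adj a b) {p q : V} {j : ℕ} (hj : j < k) (hj2 : 2 ≤ j)
    (hp : G.dist v p = j) (hq : G.dist v q = j)
    (hpa : G.dist p a = k - j) (hqb : G.dist q b = k - j) : 2 < G.dist p q := by
  -- An odd distance would be short-circuited through `v`, an even one through the edge `ab`.
  have h1 := H.two_mul_lt_of_triangle hG v p q
  have h2 := H.two_mul_lt_of_quadrangle hG p a b q
  rw [G.dist_comm (u := q) (v := v), hp, hq, Nat.odd_iff] at h1
  rw [G.dist_comm (u := b) (v := q), G.dist_comm (u := q) (v := p), hpa, hqb,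
    dist_eq_one_iff_adj.2 hab, Nat.odd_iff] at h2
  omega

end Spheres

/-! ### Concentration of the sphere and the final count -/

section Main

variable {V : Type*} [Fintype V] {G : SimpleGraph V} {k d t : ℕ} {v a b : V}

theorem OddWalksLong.four_mul_le_card_window_of_horizontal (hG : G.Connected)
    (H : OddWalksLong G k) (hd : ∀ x, d ≤ (G.nbrs x).card) (hab : G.Adj a b)
    (hva : G.dist v a = k) (hvb : G.dist v b = k) {m : ℕ} (hm1 : 1 ≤ m) (hm : 4 * m + 3 ≤ k) :
    4 * d ≤ ((univ : Finset V).filter fun z => G.dist v z / 4 = m).card := by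
  obtain ⟨p, hp, hpa⟩ := hG.exists_dist_eq hva (i := 4 * m + 1) (by omega)
  obtain ⟨q, hq, hqa⟩ := hG.exists_dist_eq hva (i := 4 * m + 2) (by omega)
  obtain ⟨p', hp', hpb⟩ := hG.exists_dist_eq hvb (i := 4 * m + 1) (by omega)
  obtain ⟨q', hq', hqb⟩ := hG.exists_dist_eq hvb (i := 4 * m + 2) (by omega)
  exact H.four_mul_le_card_window hG hd hm hp hp' hq hq'
    (H.two_lt_dist_of_geodesics hG hab (by omega) (by omega) hp hp' hpa hpb)
    (H.two_lt_dist_of_geodesics hG hab (by omega) (by omega) hq hq' hqa hqb)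
    fun _ _ => subset_univ _

/-- A third geodesic from `v` that ends far from the horizontal edge adds to the windows near
its end. -/
theorem OddWalksLong.six_mul_le_card_window_of_horizontal (hG : G.Connected)
    (H : OddWalksLong G k) (hd : ∀ x, d ≤ (G.nbrs x).card) (hab : G.Adj a b)
    (hva : G.dist v a = k) (hvb : G.dist v b = k) {u : V} (hvu : G.dist v u = k)
    {m : ℕ} (hm1 : 1 ≤ m) (hm : 4 * m + 3 ≤ k) (hu : 2 * (k - (4 * m + 1)) + 3 < G.dist u a) :
    6 * d ≤ ((univ : Finset V).filter fun z => G.dist v z / 4 = m).card := by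
  have hub : G.dist u a ≤ G.dist u b + 1 := hG.dist_le_succ_of_adj u hab
  have far : ∀ c, G.dist u a ≤ G.dist u c + 1 → ∀ j, 4 * m + 1 ≤ j → j ≤ k → ∀ p g,
      G.dist p c = k - j → G.dist g u = k - j → 2 < G.dist p g := by
    intro c hc j hj hjk p g hp hg
    have h1 := hG.dist_triangle (u := u) (v := g) (w := c)
    have h2 := hG.dist_triangle (u := g) (v := p) (w := c)
    rw [G.dist_comm (u := u) (v := g)] at h1
    rw [G.dist_comm (u := g) (v := p)] at h2
    omega
  obtain ⟨p, hp, hpa⟩ := hG.exists_dist_eq hva (i := 4 * m + 1) (by omega)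
  obtain ⟨q, hq, hqa⟩ := hG.exists_dist_eq hva (i := 4 * m + 2) (by omega)
  obtain ⟨p', hp', hpb⟩ := hG.exists_dist_eq hvb (i := 4 * m + 1) (by omega)
  obtain ⟨q', hq', hqb⟩ := hG.exists_dist_eq hvb (i := 4 * m + 2) (by omega)
  obtain ⟨g, hg, hgu⟩ := hG.exists_dist_eq hvu (i := 4 * m + 1) (by omega)
  obtain ⟨h, hh, hhu⟩ := hG.exists_dist_eq hvu (i := 4 * m + 2) (by omega)
  exact H.six_mul_le_card_window hG hd hm hp hp' hg hq hq' hh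
    (H.two_lt_dist_of_geodesics hG hab (by omega) (by omega) hp hp' hpa hpb)
    (H.two_lt_dist_of_geodesics hG hab (by omega) (by omega) hq hq' hqa hqb)
    (far a (by omega) _ le_rfl (by omega) _ _ hpa hgu) (far b hub _ le_rfl (by omega) _ _ hpb hgu)
    (far a (by omega) _ (by omega) (by omega) _ _ hqa hhu)
    (far b hub _ (by omega) (by omega) _ _ hqb hhu)

theorem le_dist_of_mem_nbrsOf (hG : G.Connected) {W : Set V} {x z : V} {r : ℕ}
    (hW : ∀ y ∈ W, r < G.dist x y) (hz : z ∈ G.nbrsOf W) : r ≤ G.dist x z := by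
  obtain ⟨y, hy, hyz⟩ := mem_nbrsOf.1 hz
  have := hG.dist_le_succ_of_adj x hyz
  have := hW y hy
  omega

/-- If the complement of a ball around `v` is not bipartite, then the sphere of radius `k` around
`v` is concentrated near the horizontal edge. -/
theorem OddWalksLong.dist_le_of_not_twoColourableOn (hG : G.Connected) (H : OddWalksLong G k)
    (hd : ∀ x, d ≤ (G.nbrs x).card) (hn : Fintype.card V ≤ (2 * k + t) * d) (hd0 : 0 < d)
    (hk : 182 + 8 * t < k) (hab : G.Adj a b) (hva : G.dist v a = k) (hvb : G.dist v b = k)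
    (hW : ¬ TwoColourableOn G {z | k - 1 < G.dist v z}) {u : V} (hu : G.dist v u = k) :
    G.dist u a ≤ 95 + 4 * t := by
  by_contra! hlt
  -- The third geodesic gains `2d` in each of `T + 1` windows, enough to beat `t` and the rounding
  -- losses. The lowest of these windows needs distance more than `23 + 8T`, which is at most `95 +
  -- 4t`.
  obtain ⟨T, hT⟩ : ∃ T, T = (t + 18) / 2 := ⟨_, rfl⟩
  obtain ⟨m₀, hm₀⟩ : ∃ m₀, m₀ = k / 4 - 2 - T := ⟨_, rfl⟩
  have h1 := H.le_card_nbrsOf hG hd hW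
  have h2 := mul_le_card_of_windows (G.dist v) univ (4 * d) 1 m₀ fun m hm hm' =>
    H.four_mul_le_card_window_of_horizontal hG hd hab hva hvb hm (by omega)
  have h3 := mul_le_card_of_windows (G.dist v) univ (6 * d) m₀ (k / 4 - 1) fun m hm hm' =>
    H.six_mul_le_card_window_of_horizontal hG hd hab hva hvb hu (by omega) (by omega) (by omega)
  have hN : ∀ z ∈ G.nbrsOf {z | k - 1 < G.dist v z}, k - 1 ≤ G.dist v z := fun z hz =>
    le_dist_of_mem_nbrsOf hG (fun _ hy => hy) hz
  have key := add_add_le_card_of_disjoint (Finset.disjoint_left.2 fun z hz hz' => ?_)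
    (Finset.disjoint_left.2 fun z hz hz' => ?_) (Finset.disjoint_left.2 fun z hz hz' => ?_) h1 h2 h3
  · have hle : ((k / 4 - 1) * 4 + (m₀ - 1) * 4 + (k / 4 - 1 - m₀) * 6) * d ≤ (2 * k + t) * d := by
      refine le_trans (le_of_eq ?_) (key.trans hn)
      ring
    have := Nat.le_of_mul_le_mul_right hle hd0
    omega
  · have := hN z hz
    simp only [mem_filter] at hz'
    omega
  · have := hN z hz
    simp only [mem_filter] at hz'
    omega
  · simp only [mem_filter] at hz hz'
    omega

/-- A connected graph whose shortest odd closed walk has length `2 * k + 1` and whose degrees are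
at least a `(2 * k + t)`-th of its order is three-colourable if `k` is large in terms of `t`. -/
theorem OddWalksLong.colorable_three_of_horizontal (hG : G.Connected) (H : OddWalksLong G k)
    (hd : ∀ x, d ≤ (G.nbrs x).card) (hn : Fintype.card V ≤ (2 * k + t) * d)
    (hk : 182 + 8 * t < k) (hab : G.Adj a b) (hva : G.dist v a = k) (hvb : G.dist v b = k) :
    G.Colorable 3 := by
  by_contra hcol
  have hd0 : 0 < d := by
    rcases Nat.eq_zero_or_pos d with rfl | h
    · have := Fintype.card_pos_iff.2 ⟨v⟩
      omega
    · exact h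
  have hW : ¬ TwoColourableOn G {z | k - 1 < G.dist v z} := fun h =>
    hcol (H.colorable_three_of_sphere hG (by omega) h)
  -- Otherwise parity of the distance from `a` two-colours everything beyond the ball around `v`.
  obtain ⟨w, hvw, haw⟩ : ∃ w, k ≤ G.dist v w ∧ k ≤ G.dist a w := by
    by_contra! hcon
    refine hW ⟨fun z => decide (Even (G.dist a z)), fun x hx y _ hxy => ?_⟩
    rw [Set.mem_ofPred_eq] at hx
    exact H.twoColourableOn_ball hG a x y hxy (hcon x (by omega))
  have hfar : 2 * k ≤ G.dist v w + (95 + 4 * t) := by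
    obtain ⟨u, hu, huw⟩ := hG.exists_dist_eq (x := v) (y := w) rfl hvw
    have h1 := H.dist_le_of_not_twoColourableOn hG hd hn hd0 hk hab hva hvb hW hu
    have h2 := hG.dist_triangle (u := a) (v := u) (w := w)
    rw [G.dist_comm (u := a) (v := u)] at h2
    omega
  -- Chosen so that `2r + 2 ≤ 2k - (95 + 4t)`, as needed to separate the spheres.
  obtain ⟨r, hr⟩ : ∃ r, r = k - 49 - 2 * t := ⟨_, rfl⟩
  have hW' : ¬ TwoColourableOn G {z | r < G.dist v z ∧ r < G.dist w z} := fun h =>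
    hcol (H.colorable_three_of_spheres hG (by omega) (by omega) h)
  have h1 := H.le_card_nbrsOf hG hd hW'
  have h2 := mul_le_card_of_windows (G.dist v) univ (4 * d) 1 (r / 4) fun m hm hm' =>
    H.four_mul_le_card_window_of_horizontal hG hd hab hva hvb hm (by omega)
  have h3 := mul_le_card_of_windows (G.dist w) univ (2 * d) 0 (r / 4) fun m hm hm' =>
    H.two_mul_le_card_window hG hd (y := v) (by omega) (by rw [dist_comm]; omega)
  have key := add_add_le_card_of_disjoint (Finset.disjoint_left.2 fun z hz hz' => ?_)
    (Finset.disjoint_left.2 fun z hz hz' => ?_) (Finset.disjoint_left.2 fun z hz hz' => ?_) h1 h2 h3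
  · have hle : ((k / 4 - 1) * 4 + (r / 4 - 1) * 4 + (r / 4 - 0) * 2) * d ≤ (2 * k + t) * d := by
      refine le_trans (le_of_eq ?_) (key.trans hn)
      ring
    have := Nat.le_of_mul_le_mul_right hle hd0
    omega
  · have := le_dist_of_mem_nbrsOf hG (x := v) (fun _ hy => hy.1) hz
    simp only [mem_filter] at hz'
    omega
  · have := le_dist_of_mem_nbrsOf hG (x := w) (fun _ hy => hy.2) hz
    simp only [mem_filter] at hz'
    omega
  · simp only [mem_filter] at hz hz'
    have := hG.dist_triangle (u := v) (v := z) (w := w)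
    rw [G.dist_comm (u := z) (v := w)] at this
    omega

theorem OddWalksLong.colorable_three_of_connected (hG : G.Connected) (H : OddWalksLong G k)
    (hd : ∀ x, d ≤ (G.nbrs x).card) (hn : Fintype.card V ≤ (2 * k + t) * d)
    (hk : 182 + 8 * t < k) : G.Colorable 3 := by
  by_cases hodd : ∃ (x : V) (c : G.Walk x x), Odd c.length
  · obtain ⟨x, c, hc⟩ := hodd
    obtain ⟨v, c₀, h₀, hmin⟩ := exists_minimal_odd_walk c hc
    obtain ⟨K, hK⟩ := id h₀
    have hkK := H v c₀ h₀
    -- Passing from `k` to the exact value `K` only weakens the bound on the order.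
    have HK : OddWalksLong G K := fun z c' h' => hK ▸ hmin z c' h'
    obtain ⟨a, b, hab, hva, hvb⟩ := exists_adj_dist_eq hG c₀ hK HK
    exact HK.colorable_three_of_horizontal (t := t) hG hd
      (hn.trans (Nat.mul_le_mul_right d (by omega))) (by omega) hab hva hvb
  · push Not at hodd
    obtain ⟨x⟩ := hG.nonempty
    -- With no odd closed walk any radius is allowed; this sum bounds all distances from `x`, so
    -- nothing lies beyond the sphere.
    have HK : OddWalksLong G (∑ y, G.dist x y + 1) :=
      fun z c' h' => absurd h' (hodd z c')
    refine HK.colorable_three_of_sphere hG (v := x)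
      (r := ∑ y, G.dist x y) (by omega)
      ⟨fun _ => true, fun z hz => ?_⟩
    have := single_le_sum (f := G.dist x) (fun _ _ => Nat.zero_le _) (mem_univ z)
    rw [Set.mem_ofPred_eq] at hz
    omega

/-- A component keeps whole neighbourhoods and has no more vertices, so the bounds in terms of `d`
pass to it. -/
theorem OddWalksLong.colorable_three (H : OddWalksLong G k)
    (hd : ∀ x, d ≤ (G.nbrs x).card) (hn : Fintype.card V ≤ (2 * k + t) * d)
    (hk : 182 + 8 * t < k) : G.Colorable 3 := by
  classical
  rw [colorable_iff_forall_connectedComponent]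
  intro C
  have : Fintype C := Fintype.ofFinite C
  refine OddWalksLong.colorable_three_of_connected (k := k) (d := d) (t := t)
    C.connected_toSimpleGraph ?_ ?_ ?_ hk
  · intro x c hc
    have := H _ (c.map C.toSimpleGraph_hom)
    rw [Walk.length_map] at this
    exact this hc
  · intro x
    refine (hd x).trans (card_le_card_of_surjOn (fun y : C => (y : V)) fun z hz => ?_)
    have hz' := mem_nbrs.1 hz
    have hzC : z ∈ C.supp := (C.mem_supp_congr_adj hz').1 x.2
    exact ⟨⟨z, hzC⟩, mem_coe.2 (mem_nbrs.2 hz'), rfl⟩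
  · exact (Fintype.card_le_of_injective (fun y : C => (y : V)) Subtype.val_injective).trans hn

end Main

end SimpleGraph

/-! ### The theorem in terms of minimum degree and the chromatic profile -/

theorem colorable_three_of_minDegree {t k : ℕ} (hk : 5490 + 45 * t ≤ k) {V : Type*} [Fintype V]
    (G : SimpleGraph V) [DecidableRel G.Adj] (hfree : FamilyFree (oddCycleFamily (2 * k - 1)) G)
    (hdeg : 1 / (2 * (k : ℝ) + (t : ℝ)) * (Fintype.card V : ℝ) ≤ (G.minDegree : ℝ)) :
    G.Colorable 3 := by
  refine (SimpleGraph.oddWalksLong_of_familyFree hfree).colorable_three (d := G.minDegree) (t := t)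
    (fun x => ?_) ?_ (by omega)
  · refine (G.minDegree_le_degree x).trans (le_of_eq ?_)
    rw [← SimpleGraph.card_neighborFinset_eq_degree]
    congr 1
    ext z
    simp [SimpleGraph.mem_nbrs]
  · have hpos : (0 : ℝ) < 2 * (k : ℝ) + (t : ℝ) := by
      have : (0 : ℝ) < k := by exact_mod_cast (by omega : 0 < k)
      positivity
    rw [one_div, inv_mul_le_iff₀ hpos] at hdeg
    exact_mod_cast hdeg

theorem theorem1 (t k : ℕ) (hk : 5490 + 45 * t ≤ k) :
    (∀ (V : Type*) [Fintype V] (G : SimpleGraph V) [DecidableRel G.Adj],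
      FamilyFree (oddCycleFamily (2 * k - 1)) G →
      1 / (2 * (k : ℝ) + (t : ℝ)) * (Fintype.card V : ℝ) ≤ (G.minDegree : ℝ) →
      G.Colorable 3) ∧
    chromaticProfile (oddCycleFamily (2 * k - 1)) 3 ≤ 1 / (2 * (k : ℝ) + (t : ℝ)) := by
  refine ⟨fun V _ G _ hfree hdeg => colorable_three_of_minDegree hk G hfree hdeg,
    csInf_le (profileSet_bddBelow _ _) ⟨⟨by positivity, ?_⟩, fun V _ G _ h =>
      (colorable_three_of_minDegree hk G h.1 h.2).chromaticNumber_le⟩⟩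
  have hk' : (1 : ℝ) ≤ k := by exact_mod_cast (by omega : 1 ≤ k)
  have ht : (0 : ℝ) ≤ t := by positivity
  exact div_le_one_of_le₀ (by linarith) (by linarith)
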